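/- Let $\alpha_k=\lceil 2^k/k^2\rceil$ for $k\ge 1$. Let $S$ be the following infinite rooted graph with edges labelled by $a,b$. Level $1$ consists of one cycle of length $2\alpha_1$, whose starting point is the root $o$; for every $k\ge 1$, each cycle $C$ of level $k$ is joined to two new cycles of level $k+1$, each of length $2\alpha_{k+1}$, by a 3-cycle (the branching cycle) whose vertices are the point of $C$ opposite to its starting point and the starting points of the two new cycles. Let $a$ be the permutation of the vertices of $S$ that moves every vertex one step forward along its (consistently oriented) cycle of length $2\alpha_k$, and let $b$ be the permutation that rotates every branching cycle cyclically and fixes every other vertex. Let $\Gamma$ be the group of permutations of $S$ generated by $a$ and $b$, acting on $S$ from the right by $(x,g)\mapsto x.g$. Let $G=\mathbb{Z}_2\wr_S\Gamma=\bigl(\bigoplus_S\mathbb{Z}_2\bigr)\rtimes\Gamma$ be the permutational wreath product, with multiplication $(f,g)(f',g')=(f+f'(\,\cdot\,.g),\,gg')$ and identity $e$. Let $\tilde X_n=\prod_{i=1}^n (l_i,1)(0,g_i)(l_i',1)$ be the switch-walk-switch random walk on $G$, where all $g_i,l_i,l_i'$ are independent, each $g_i$ is uniformly chosen from $a,b,a^{-1},b^{-1}$,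 and each $l_i,l_i'$ is a configuration that vanishes off $o$ and whose value at $o$ is uniform in $\mathbb{Z}_2$. Let $p_n(g,h)$ be the probability that this walk, started at $g$, is at $h$ after $n$ steps. Then there are constants $c,K>0$ and a function $f:\mathbb{N}\to\mathbb{R}$ with $f(n)\to 0$ as $n\to\infty$ such that for all $n\ge 1$ $$p_{2n}(e,e)\ \ge\ K\,e^{-c\,n^{1/2+f(n)}}.$$ -/

import Mathlib

open Filter Topology

noncomputable section

namespace BubbleGroup

/-- Vertices of the graph `S(α)`. The cycles of level `k` are indexed by the binary words `w` of
length `k - 1` (the most recent branching choice is the head of the list), and the cycle indexed by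
`w` is the cyclic group `ℤ / 2α_k`. Position `0` is the starting point of the cycle, position `α_k`
is its middle (rightmost) point. -/
abbrev Vertex (α : ℕ+ → ℕ+) : Type :=
  Σ w : List Bool, ZMod (2 * (α w.length.succPNat : ℕ))

/-- The middle point of the cycle indexed by `w`. -/
def mid (α : ℕ+ → ℕ+) (w : List Bool) : ZMod (2 * (α w.length.succPNat : ℕ)) :=
  ((α w.length.succPNat : ℕ) : ZMod (2 * (α w.length.succPNat : ℕ)))

/-- The root `o`: the starting point of the unique cycle of level one. -/
def root (α : ℕ+ → ℕ+) : Vertex α := ⟨[], 0⟩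

/-- The generator `a` moves every vertex one step forward along its cycle. -/
def permA (α : ℕ+ → ℕ+) : Equiv.Perm (Vertex α) :=
  Equiv.sigmaCongrRight fun _ => Equiv.addRight 1

/-- The generator `b` rotates every branching cycle, whose three vertices are the middle point of a
cycle `w` and the starting points of the two cycles `false :: w`, `true :: w` of the next level.
It fixes all other vertices, in particular the root. -/
def stepB (α : ℕ+ → ℕ+) (x : Vertex α) : Vertex α :=
  if x.2 = mid α x.1 then ⟨false :: x.1, 0⟩
  else if x.2 = 0 then
    match x.1 with
    | [] => root α
    | false :: v => ⟨true :: v, 0⟩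
    | true :: v => ⟨v, mid α v⟩
  else x

theorem mid_ne_zero (α : ℕ+ → ℕ+) (w : List Bool) : mid α w ≠ 0 := by
  intro h
  have h' := (ZMod.natCast_eq_zero_iff _ _).1 h
  have hp := (α w.length.succPNat).pos
  have := Nat.le_of_dvd hp h'
  omega

theorem stepB_mid (α : ℕ+ → ℕ+) (w : List Bool) : stepB α ⟨w, mid α w⟩ = ⟨false :: w, 0⟩ := by
  simp [stepB]

theorem stepB_false (α : ℕ+ → ℕ+) (w : List Bool) :
    stepB α ⟨false :: w, 0⟩ = ⟨true :: w, 0⟩ := by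
  simp [stepB, (mid_ne_zero α (false :: w)).symm]

theorem stepB_true (α : ℕ+ → ℕ+) (w : List Bool) : stepB α ⟨true :: w, 0⟩ = ⟨w, mid α w⟩ := by
  simp [stepB, (mid_ne_zero α (true :: w)).symm]

theorem stepB_root (α : ℕ+ → ℕ+) : stepB α (root α) = root α := by
  exact (if_neg (mid_ne_zero α []).symm).trans (if_pos rfl)

theorem stepB_other (α : ℕ+ → ℕ+) (x : Vertex α) (h : x.2 ≠ mid α x.1) (h0 : x.2 ≠ 0) :
    stepB α x = x := by
  simp [stepB, h, h0]

theorem stepB_stepB_stepB (α : ℕ+ → ℕ+) (x : Vertex α) :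
    stepB α (stepB α (stepB α x)) = x := by
  by_cases h : x.2 = mid α x.1
  · obtain ⟨w, i⟩ := x
    obtain rfl : i = mid α w := h
    rw [stepB_mid, stepB_false, stepB_true]
  by_cases h0 : x.2 = 0
  · obtain ⟨w, i⟩ := x
    obtain rfl : i = 0 := h0
    match w with
    | [] => exact (by simp only [stepB_root] :
        stepB α (stepB α (stepB α (root α))) = root α)
    | false :: v => rw [stepB_false, stepB_true, stepB_mid]
    | true :: v => rw [stepB_true, stepB_mid, stepB_false]
  · simp only [stepB_other α x h h0]

/-- The generator `b` as a permutation of the vertices. -/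
def permB (α : ℕ+ → ℕ+) : Equiv.Perm (Vertex α) where
  toFun := stepB α
  invFun x := stepB α (stepB α x)
  left_inv := stepB_stepB_stepB α
  right_inv := stepB_stepB_stepB α

/-- The bubble group `Γ(α)`, generated by `a` and `b`. It acts on the vertices from the right, so it
is a subgroup of the opposite of the permutation group: `x.g` is `g.unop x` and
`x.(g h) = (x.g).h`. -/
def bubbleGroup (α : ℕ+ → ℕ+) : Subgroup (Equiv.Perm (Vertex α))ᵐᵒᵖ :=
  Subgroup.closure {MulOpposite.op (permA α), MulOpposite.op (permB α)}

/-- The generator `a` as an element of the bubble group. -/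
def genA (α : ℕ+ → ℕ+) : bubbleGroup α :=
  ⟨MulOpposite.op (permA α), Subgroup.subset_closure (by simp)⟩

/-- The generator `b` as an element of the bubble group. -/
def genB (α : ℕ+ → ℕ+) : bubbleGroup α :=
  ⟨MulOpposite.op (permB α), Subgroup.subset_closure (by simp)⟩

/-- The right action `x.g` of the bubble group on the vertices. -/
def act {α : ℕ+ → ℕ+} (x : Vertex α) (g : bubbleGroup α) : Vertex α :=
  (MulOpposite.unop (g : (Equiv.Perm (Vertex α))ᵐᵒᵖ)) x

/-- Finitely supported lamp configurations `⨁_S ℤ₂`, written multiplicatively. -/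
abbrev Lamps (α : ℕ+ → ℕ+) : Type := Multiplicative (Vertex α →₀ ZMod 2)

/-- The action of the bubble group on lamp configurations, `(g • f)(x) = f(x.g)`. -/
def lampAction (α : ℕ+ → ℕ+) : bubbleGroup α →* MulAut (Lamps α) where
  toFun g := AddEquiv.toMultiplicative
    (Finsupp.domCongr (MulOpposite.unop (g : (Equiv.Perm (Vertex α))ᵐᵒᵖ)).symm)
  map_one' := by
    ext f
    rfl
  map_mul' g h := by
    ext f
    rfl

theorem lampAction_apply {α : ℕ+ → ℕ+} (g : bubbleGroup α) (f : Lamps α) (x : Vertex α) :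
    (lampAction α g f).toAdd x = f.toAdd (act x g) := rfl

/-- The permutational wreath product `ℤ₂ ≀_S Γ`, with
`(f, g) (f', g') = (f + f'(·.g), g g')`. -/
abbrev Wreath (α : ℕ+ → ℕ+) : Type := Lamps α ⋊[lampAction α] bubbleGroup α

/-- The switch: the configuration with value `L` at the root and `0` elsewhere, as an element of
the wreath product. -/
def switch (α : ℕ+ → ℕ+) (L : ZMod 2) : Wreath α :=
  SemidirectProduct.inl (Multiplicative.ofAdd (Finsupp.single (root α) L))

/-- The step distribution of the simple random walk on the bubble group: each of
`a, b, a⁻¹, b⁻¹` is chosen with probability `1/4`. -/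
def baseStep (α : ℕ+ → ℕ+) : PMF (bubbleGroup α) :=
  (PMF.uniformOfFintype (Fin 4)).map ![genA α, genB α, (genA α)⁻¹, (genB α)⁻¹]

/-- The step distribution of the switch-walk-switch random walk: the law of
`(l, 1) (0, g) (l', 1)`, where `l`, `l'` are switches with uniform values in `ℤ₂`, `g` is a step of
the simple random walk on the bubble group, and `l`, `g`, `l'` are independent. -/
def swsStep (α : ℕ+ → ℕ+) : PMF (Wreath α) :=
  (PMF.uniformOfFintype (ZMod 2)).bind fun L =>
    (baseStep α).bind fun g =>
      (PMF.uniformOfFintype (ZMod 2)).map fun L' =>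
        switch α L * SemidirectProduct.inr g * switch α L'

/-- The law at time `n` of the switch-walk-switch random walk started at `g`, whose independent
increments with law `swsStep` are multiplied on the right. -/
def walk (α : ℕ+ → ℕ+) (g : Wreath α) : ℕ → PMF (Wreath α)
  | 0 => PMF.pure g
  | n + 1 => (walk α g n).bind fun x => (swsStep α).map fun s => x * s

/-- The transition probability `p_n(g, h)`. -/
def transProb (α : ℕ+ → ℕ+) (n : ℕ) (g h : Wreath α) : ℝ := (walk α g n h).toReal

/-- The scaling sequence `α_k = ⌈2^k / k^2⌉`. -/
def scaling (k : ℕ+) : ℕ+ :=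
  ⟨⌈(2 : ℝ) ^ (k : ℕ) / (k : ℝ) ^ 2⌉₊, Nat.ceil_pos.2 (by positivity)⟩

end BubbleGroup

end

/-!
Call a word in `a, b` confined if the total exponent of `a` stays in `[-r, r]` along all its
prefixes. If `2 r < α_k` for all `k > N`, such a word cannot carry a vertex from one branching
cycle above level `N` to another one, so on the high levels its permutation looks the same around
every branching cycle. It is therefore determined by its total exponent and its restriction to the
roughly `4 ^ N` vertices of levels at most `N + 2`; the lamps it visits are on the low levels too.
Hence the confined elements form a set `A` with `log |A| = O(N 4 ^ N)`. The exponent of `a` is a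
lazy random walk on `ℤ`, which stays in `[-r, r]` for `n` steps with probability at least
`exp (-O(n / r ^ 2))`. Since the walk is symmetric, Cauchy-Schwarz gives
`p_{2n}(e, e) ≥ P(X_n ∈ A) ^ 2 / |A|`. For the scaling sequence one may take `r` of order
`2 ^ N / N ^ 2`, and `16 ^ N` of order `n` balances the two exponents.
-/

noncomputable section

namespace BubbleGroup

/-! ### Markov chains -/

section MarkovChain

variable {β γ : Type*}

theorem tsum_bind_mul (p : PMF β) (q : β → PMF γ) (H : γ → ENNReal) :
    ∑' z, p.bind q z * H z = ∑' y, p y * ∑' z, q y z * H z := by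
  simp only [PMF.bind_apply, ← ENNReal.tsum_mul_right, ← ENNReal.tsum_mul_left, mul_assoc]
  exact ENNReal.tsum_comm

theorem tsum_map_mul (p : PMF β) (f : β → γ) (H : γ → ENNReal) :
    ∑' z, p.map f z * H z = ∑' y, p y * H (f y) := by
  rw [PMF.map, tsum_bind_mul]
  simp [PMF.pure_apply]

theorem uniformOfFintype_prod [Fintype β] [Nonempty β] [Fintype γ] [Nonempty γ] :
    PMF.uniformOfFintype (β × γ) =
      (PMF.uniformOfFintype β).bind fun b => (PMF.uniformOfFintype γ).map (Prod.mk b) := by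
  classical
  ext ⟨b, c⟩
  have h : ∀ a, (PMF.uniformOfFintype γ).map (Prod.mk a) (b, c) =
      if a = b then (Fintype.card γ : ENNReal)⁻¹ else 0 := fun a => by
    by_cases hab : a = b <;> simp [PMF.map_apply, hab, Ne.symm, Prod.ext_iff, tsum_fintype]
  simp [PMF.bind_apply, h, ENNReal.mul_inv]

/-- The law at time `n` of the Markov chain with transition kernel `K` started at `x`. -/
def markovChain (K : β → PMF β) (x : β) : ℕ → PMF β
  | 0 => PMF.pure x
  | n + 1 => (markovChain K x n).bind K

variable {K : β → PMF β}

theorem markovChain_add (x : β) (m n : ℕ) :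
    markovChain K x (m + n) = (markovChain K x m).bind fun y => markovChain K y n := by
  induction n with
  | zero => simp [markovChain]
  | succ n ih => rw [← add_assoc, markovChain, ih, PMF.bind_bind]; rfl

theorem markovChain_succ_eq_bind (x : β) (n : ℕ) :
    markovChain K x (n + 1) = (K x).bind fun y => markovChain K y n := by
  rw [add_comm, markovChain_add]
  simp [markovChain]

theorem markovChain_apply_comm (hK : ∀ x y, K x y = K y x) (n : ℕ) (x y : β) :
    markovChain K x n y = markovChain K y n x := by
  induction n generalizing x y with
  | zero =>
    rcases eq_or_ne x y with rfl | h
    · rfl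
    · simp [markovChain, PMF.pure_apply, h, h.symm]
  | succ n ih =>
    rw [markovChain_succ_eq_bind, markovChain, PMF.bind_apply, PMF.bind_apply]
    exact tsum_congr fun z => by rw [hK x z, ih z y, mul_comm]

theorem sum_sq_markovChain_le (hK : ∀ x y, K x y = K y x) (x : β) (n : ℕ) (A : Finset β) :
    ∑ y ∈ A, markovChain K x n y ^ 2 ≤ markovChain K x (2 * n) x := by
  rw [two_mul, markovChain_add, PMF.bind_apply]
  simp only [markovChain_apply_comm hK n _ x, ← sq]
  exact ENNReal.sum_le_tsum A

theorem sq_toOuterMeasure_markovChain_le (hK : ∀ x y, K x y = K y x) (x : β) (n : ℕ)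
    {A : Set β} (hA : A.Finite) :
    ((markovChain K x n).toOuterMeasure A).toReal ^ 2 ≤
      A.ncard * (markovChain K x (2 * n) x).toReal := by
  have hsum := ENNReal.toReal_mono (PMF.apply_ne_top _ _)
    (sum_sq_markovChain_le hK x n hA.toFinset)
  rw [ENNReal.toReal_sum fun y _ => ENNReal.pow_ne_top (PMF.apply_ne_top _ y)] at hsum
  simp only [ENNReal.toReal_pow] at hsum
  rw [Set.ncard_eq_toFinset_card A hA]
  nth_rewrite 1 [← hA.coe_toFinset]
  rw [PMF.toOuterMeasure_apply_finset, ENNReal.toReal_sum fun y _ => PMF.apply_ne_top _ y]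
  exact sq_sum_le_card_mul_sum_sq.trans (by gcongr)

section SubEigenfunction

variable {c : ENNReal} {H : β → ENNReal}

theorem pow_mul_le_tsum_markovChain (hH : ∀ x, c * H x ≤ ∑' y, K x y * H y) (x : β) (n : ℕ) :
    c ^ n * H x ≤ ∑' y, markovChain K x n y * H y := by
  induction n with
  | zero => simp [markovChain, PMF.pure_apply]
  | succ n ih =>
    calc c ^ (n + 1) * H x = c * (c ^ n * H x) := by rw [pow_succ', mul_assoc]
      _ ≤ c * ∑' y, markovChain K x n y * H y := by gcongr
      _ = ∑' y, markovChain K x n y * (c * H y) := by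
        simp only [← ENNReal.tsum_mul_left, mul_left_comm c]
      _ ≤ ∑' y, markovChain K x n y * ∑' z, K y z * H z := by gcongr; exact hH _
      _ = ∑' z, markovChain K x (n + 1) z * H z := by rw [markovChain, tsum_bind_mul]

theorem pow_mul_le_toOuterMeasure_markovChain (hH : ∀ x, c * H x ≤ ∑' y, K x y * H y)
    {A : Set β} (hHA : H ≤ A.indicator 1) (x : β) (n : ℕ) :
    c ^ n * H x ≤ (markovChain K x n).toOuterMeasure A := by
  refine (pow_mul_le_tsum_markovChain hH x n).trans ?_
  rw [PMF.toOuterMeasure_apply]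
  gcongr with y
  calc markovChain K x n y * H y ≤ markovChain K x n y * A.indicator 1 y := by gcongr; exact hHA y
    _ = A.indicator (markovChain K x n) y := by by_cases hy : y ∈ A <;> simp [hy]

end SubEigenfunction

theorem map_mul_left_apply_comm {ι G : Type*} [Group G] (p : PMF ι) (s : ι → G) {σ : ι → ι}
    (hσ : σ.Involutive) (hp : ∀ i, p (σ i) = p i) (hs : ∀ i, s (σ i) = (s i)⁻¹) (x y : G) :
    p.map (x * s ·) y = p.map (y * s ·) x := by
  classical
  rw [PMF.map_apply, PMF.map_apply, ← hσ.toPerm.tsum_eq]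
  refine tsum_congr fun i => ?_
  simp only [Function.Involutive.coe_toPerm, hs, hp, eq_mul_inv_iff_mul_eq, eq_comm (a := x)]

end MarkovChain

variable {α : ℕ+ → ℕ+}

/-! ### The permutations near the branching cycles -/

section Chart

/-- The chart around the branching cycle attached to the middle point of the cycle `w`: three lines,
wrapped onto the cycles `w`, `false :: w` and `true :: w`, whose origins are the three vertices of
the branching cycle. -/
def chart (α : ℕ+ → ℕ+) (w : List Bool) : Option Bool → ℤ → Vertex α
  | none, j => ⟨w, mid α w + j⟩
  | some c, j => ⟨c :: w, j⟩

/-- The effect of `b` on the three lines of a chart. -/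
def rot : Option Bool → Option Bool
  | none => some false
  | some false => some true
  | some true => none

theorem permA_zpow_apply (k : ℤ) (x : Vertex α) : (permA α ^ k) x = ⟨x.1, x.2 + k⟩ := by
  have h : permA α ^ k = Equiv.Perm.sigmaCongrRightHom _ fun _ => Equiv.addRight 1 ^ k :=
    (map_zpow (Equiv.Perm.sigmaCongrRightHom _) (fun _ => Equiv.addRight 1) k).symm
  simp [h]

theorem permB_inv : (permB α)⁻¹ = permB α * permB α := by
  ext1 x
  rfl

theorem permA_zpow_chart (k : ℤ) (w : List Bool) (τ : Option Bool) (j : ℤ) :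
    (permA α ^ k) (chart α w τ j) = chart α w τ (j + k) := by
  cases τ <;> simp [chart, permA_zpow_apply, add_assoc]

theorem stepB_chart_zero (w : List Bool) (τ : Option Bool) :
    stepB α (chart α w τ 0) = chart α w (rot τ) 0 := by
  rcases τ with _ | _ | _
  · simpa [chart, rot] using stepB_mid α w
  · simpa [chart, rot] using stepB_false α w
  · simpa [chart, rot] using stepB_true α w

theorem eq_of_chart_eq_chart {w : List Bool} {τ τ' : Option Bool} {j j' : ℤ}
    (h : chart α w τ j = chart α w τ' j') : τ = τ' := by
  have hfst := congrArg Sigma.fst h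
  cases τ <;> cases τ' <;> simp_all [chart]

theorem le_length_chart (w : List Bool) (τ : Option Bool) (j : ℤ) :
    w.length ≤ (chart α w τ j).1.length := by
  cases τ <;> simp [chart]

theorem length_chart_le (w : List Bool) (τ : Option Bool) (j : ℤ) :
    (chart α w τ j).1.length ≤ w.length + 1 := by
  cases τ <;> simp [chart]

variable {w : List Bool} {j : ℤ}

theorem intCast_ne_zero_of_abs_lt (hj0 : j ≠ 0) (hj : |j| < α w.length.succPNat) :
    (j : ZMod (2 * (α w.length.succPNat : ℕ))) ≠ 0 := by
  rw [Ne, ZMod.intCast_zmod_eq_zero_iff_dvd]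
  exact fun hdvd => hj0 (Int.eq_zero_of_abs_lt_dvd hdvd (by push_cast; linarith [abs_nonneg j]))

theorem intCast_ne_mid_of_abs_lt (hj : |j| < α w.length.succPNat) :
    (j : ZMod (2 * (α w.length.succPNat : ℕ))) ≠ mid α w := by
  intro h
  have hsub : ((j - (α w.length.succPNat : ℕ) : ℤ) : ZMod (2 * (α w.length.succPNat : ℕ))) = 0 := by
    push_cast
    exact sub_eq_zero.2 h
  rw [ZMod.intCast_zmod_eq_zero_iff_dvd] at hsub
  obtain ⟨hneg, hpos⟩ := abs_lt.1 hj
  have := Int.eq_zero_of_abs_lt_dvd hsub (by push_cast; rw [abs_lt]; constructor <;> linarith)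
  linarith

theorem mid_add_mid (w : List Bool) : mid α w + mid α w = 0 := by
  rw [mid, ← two_mul]
  exact_mod_cast ZMod.natCast_self (2 * (α w.length.succPNat : ℕ))

theorem stepB_chart_of_ne_zero {τ : Option Bool} (hj0 : j ≠ 0)
    (hj : |j| < α (chart α w τ j).1.length.succPNat) :
    stepB α (chart α w τ j) = chart α w τ j := by
  rcases τ with _ | c
  · change |j| < α w.length.succPNat at hj
    refine stepB_other _ _ ?_ fun h => intCast_ne_mid_of_abs_lt hj ?_
    · simpa [chart] using intCast_ne_zero_of_abs_lt hj0 hj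
    · exact add_left_cancel (h.trans (mid_add_mid w).symm)
  · exact stepB_other _ _ (intCast_ne_mid_of_abs_lt hj) (intCast_ne_zero_of_abs_lt hj0 hj)

end Chart

/-! ### Confined permutations -/

section Confined

/-- The vertices on the cycles of level at most `N`, and those on the cycles of level `N + 1` within
distance `r` of position `m`. -/
def core (α : ℕ+ → ℕ+) (N r : ℕ) (m : ℤ) : Set (Vertex α) :=
  {x | x.1.length < N ∨ x.1.length = N ∧ ∃ j : ℤ, |j| ≤ r ∧ x.2 = ((j + m : ℤ) : ZMod _)}

/-- A vertex is far from the branching cycles if moving at most `r` steps along its own cycle, in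
either direction, reaches neither the starting point nor the middle point. -/
def IsFar (r : ℕ) (x : Vertex α) : Prop :=
  ∀ j : ℤ, |j| ≤ r → x.2 + j ≠ 0 ∧ x.2 + j ≠ mid α x.1

/-- The properties of the permutation given by a word in `a` and `b` whose total exponent in `a` is
`m` and whose prefixes all have total exponent in `[-r, r]`: on the levels above `N` it is the
shift by `m` far from the branching cycles, and near a branching cycle it is the shift by `m`
combined with a change of line that depends on the position in the chart but not on the branching
cycle. -/
structure Confined (N r : ℕ) (m : ℤ) (p : Equiv.Perm (Vertex α)) : Prop where
  apply_of_isFar : ∀ x, N ≤ x.1.length → IsFar r x → p x = (permA α ^ m) x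
  exists_apply_chart : ∃ σ : Option Bool → ℤ → Option Bool, ∀ w, N ≤ w.length →
    ∀ τ (j : ℤ), |j| ≤ r → p (chart α w τ j) = chart α w (σ τ j) (j + m)
  mapsTo_core : Set.MapsTo p (core α N r 0) (core α N r m)

variable {N r : ℕ} {m : ℤ} {x : Vertex α} {p q : Equiv.Perm (Vertex α)}

theorem length_le_of_mem_core (hx : x ∈ core α N r m) : x.1.length ≤ N :=
  hx.elim le_of_lt fun h => h.1.le

theorem mk_zero_mem_core (hm : |m| ≤ r) {w : List Bool} (hw : w.length ≤ N) :
    (⟨w, 0⟩ : Vertex α) ∈ core α N r m :=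
  hw.lt_or_eq.imp id fun hw => ⟨hw, -m, by simpa using hm, by simp⟩

theorem permA_zpow_mem_core (hx : x ∈ core α N r m) (k : ℤ) :
    (permA α ^ k) x ∈ core α N r (m + k) := by
  rw [permA_zpow_apply]
  refine hx.imp id fun ⟨hN, j, hj, hxj⟩ => ⟨hN, j, hj, ?_⟩
  rw [hxj, ← Int.cast_add, add_assoc]

theorem stepB_mem_core (hα : 2 * r < (α N.succPNat : ℕ)) (hm : |m| ≤ r) (hx : x ∈ core α N r m) :
    stepB α x ∈ core α N r m := by
  obtain ⟨w, i⟩ := x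
  by_cases hmid : i = mid α w
  · subst hmid
    rw [stepB_mid]
    refine mk_zero_mem_core hm (hx.resolve_right ?_)
    rintro ⟨rfl, j, hj, hxj⟩
    refine intCast_ne_mid_of_abs_lt ?_ hxj.symm
    have := abs_add_le j m
    lia
  by_cases h0 : i = 0
  · subst h0
    have hw : w.length ≤ N := length_le_of_mem_core hx
    match w with
    | [] => exact (stepB_root α).symm ▸ hx
    | false :: v => exact stepB_false α v ▸ mk_zero_mem_core hm hw
    | true :: v => exact stepB_true α v ▸ Or.inl hw
  · rwa [stepB_other α _ hmid h0]

theorem mem_core_or_eq_chart_or_isFar (N r : ℕ) (x : Vertex α) :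
    x ∈ core α N r 0 ∨ (∃ w τ, ∃ j : ℤ, N ≤ w.length ∧ |j| ≤ r ∧ x = chart α w τ j) ∨
      N ≤ x.1.length ∧ IsFar r x := by
  obtain ⟨w, i⟩ := x
  rcases lt_or_ge w.length N with hw | hw
  · exact Or.inl (Or.inl hw)
  by_cases hfar : IsFar r (⟨w, i⟩ : Vertex α)
  · exact Or.inr (Or.inr ⟨hw, hfar⟩)
  simp only [IsFar, not_forall, not_and_or, not_not] at hfar
  obtain ⟨j, hj, h0 | hmid⟩ := hfar
  · obtain rfl : i = ((-j : ℤ) : ZMod _) := by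
      rw [Int.cast_neg]
      exact eq_neg_of_add_eq_zero_left h0
    rcases hw.eq_or_lt with hw | hw
    · exact Or.inl (Or.inr ⟨hw.symm, -j, by simpa using hj, by simp⟩)
    · obtain ⟨c, v, rfl⟩ := List.exists_cons_of_length_pos (N.zero_le.trans_lt hw)
      exact Or.inr (Or.inl ⟨v, some c, -j, Nat.lt_succ_iff.1 hw, by simpa using hj, rfl⟩)
  · refine Or.inr (Or.inl ⟨w, none, -j, hw, by simpa using hj, ?_⟩)
    simp [chart, ← hmid]

namespace Confined

theorem one (N r : ℕ) : Confined N r 0 (1 : Equiv.Perm (Vertex α)) where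
  apply_of_isFar x _ _ := by simp
  exists_apply_chart := ⟨fun τ _ => τ, by simp⟩
  mapsTo_core _ hx := hx

theorem permA_zpow_mul (h : Confined N r m p) (k : ℤ) :
    Confined N r (m + k) (permA α ^ k * p) where
  apply_of_isFar x hx hfar := by
    rw [Equiv.Perm.mul_apply, h.apply_of_isFar x hx hfar, ← Equiv.Perm.mul_apply, ← zpow_add,
      add_comm]
  exists_apply_chart := by
    obtain ⟨σ, hσ⟩ := h.exists_apply_chart
    refine ⟨σ, fun w hw τ j hj => ?_⟩
    rw [Equiv.Perm.mul_apply, hσ w hw τ j hj, permA_zpow_chart, add_assoc]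
  mapsTo_core _ hx := permA_zpow_mem_core (h.mapsTo_core hx) k

theorem permB_mul (hα : ∀ k, N ≤ k → 2 * r < (α k.succPNat : ℕ)) (hm : |m| ≤ r)
    (h : Confined N r m p) : Confined N r m (permB α * p) where
  apply_of_isFar x hx hfar := by
    rw [Equiv.Perm.mul_apply, h.apply_of_isFar x hx hfar, permA_zpow_apply]
    exact stepB_other _ _ (hfar m hm).2 (hfar m hm).1
  exists_apply_chart := by
    obtain ⟨σ, hσ⟩ := h.exists_apply_chart
    refine ⟨fun τ j => if j + m = 0 then rot (σ τ j) else σ τ j, fun w hw τ j hj => ?_⟩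
    rw [Equiv.Perm.mul_apply, hσ w hw τ j hj]
    change stepB α _ = chart α w (if _ then _ else _) _
    split_ifs with h0
    · rw [h0, stepB_chart_zero]
    · refine stepB_chart_of_ne_zero h0 ?_
      have := hα _ (hw.trans (le_length_chart (α := α) w (σ τ j) (j + m)))
      have := abs_add_le j m
      lia
  mapsTo_core _ hx := stepB_mem_core (hα N le_rfl) hm (h.mapsTo_core hx)

theorem permB_inv_mul (hα : ∀ k, N ≤ k → 2 * r < (α k.succPNat : ℕ)) (hm : |m| ≤ r)
    (h : Confined N r m p) : Confined N r m ((permB α)⁻¹ * p) := by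
  rw [permB_inv, mul_assoc]
  exact (h.permB_mul hα hm).permB_mul hα hm

theorem le_length_apply (h : Confined N r m p) (hx : x ∉ core α N r 0) : N ≤ (p x).1.length := by
  rcases mem_core_or_eq_chart_or_isFar N r x with hcore | ⟨w, τ, j, hw, hj, rfl⟩ | ⟨hN, hfar⟩
  · exact absurd hcore hx
  · obtain ⟨σ, hσ⟩ := h.exists_apply_chart
    rw [hσ w hw τ j hj]
    exact hw.trans (le_length_chart ..)
  · rwa [h.apply_of_isFar x hN hfar, permA_zpow_apply]

theorem eq_of_eq_of_length_le (hp : Confined N r m p) (hq : Confined N r m q)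
    (h : ∀ x : Vertex α, x.1.length ≤ N + 1 → (p x).1.length ≤ N + 1 →
      (q x).1.length ≤ N + 1 → p x = q x) : p = q := by
  ext1 x
  rcases mem_core_or_eq_chart_or_isFar N r x with hx | ⟨w, τ, j, hw, hj, rfl⟩ | ⟨hN, hfar⟩
  · have hlen {m : ℤ} {y : Vertex α} (hy : y ∈ core α N r m) : y.1.length ≤ N + 1 :=
      (length_le_of_mem_core hy).trans N.le_succ
    exact h x (hlen hx) (hlen (hp.mapsTo_core hx)) (hlen (hq.mapsTo_core hx))
  · obtain ⟨σ, hσ⟩ := hp.exists_apply_chart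
    obtain ⟨σ', hσ'⟩ := hq.exists_apply_chart
    -- The line permutations do not depend on the chart, so they can be compared at level `N + 1`.
    let v := List.replicate N false
    have hv : N ≤ v.length := List.length_replicate.ge
    have hlen (τ j) : (chart α v τ j).1.length ≤ N + 1 :=
      (length_chart_le v τ j).trans (by simp [v])
    have hpq := h (chart α v τ j) (hlen _ _)
      (by rw [hσ v hv τ j hj]; exact hlen _ _) (by rw [hσ' v hv τ j hj]; exact hlen _ _)
    rw [hσ v hv τ j hj, hσ' v hv τ j hj] at hpq
    rw [hσ w hw τ j hj, hσ' w hw τ j hj, eq_of_chart_eq_chart hpq]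
  · rw [hp.apply_of_isFar x hN hfar, hq.apply_of_isFar x hN hfar]

end Confined

end Confined

/-! ### The switch-walk-switch chain -/

section Kernel

/-- The vertex permutation `x ↦ x.g`, freed from the opposite group. -/
def toPerm (g : bubbleGroup α) : Equiv.Perm (Vertex α) :=
  MulOpposite.unop (g : (Equiv.Perm (Vertex α))ᵐᵒᵖ)

/-- The generators `a, b, a⁻¹, b⁻¹` of the bubble group. -/
def gen (α : ℕ+ → ℕ+) : Fin 4 → bubbleGroup α :=
  ![genA α, genB α, (genA α)⁻¹, (genB α)⁻¹]

/-- The exponent of `a` in each of the generators `a, b, a⁻¹, b⁻¹`. -/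
def genExponent : Fin 4 → ℤ :=
  ![1, 0, -1, 0]

/-- The random choices made in one step of the walk: a switch, a generator and a switch. -/
abbrev Letter : Type := ZMod 2 × Fin 4 × ZMod 2

/-- The increment of the walk for given random choices. -/
def increment (α : ℕ+ → ℕ+) (s : Letter) : Wreath α :=
  switch α s.1 * SemidirectProduct.inr (gen α s.2.1) * switch α s.2.2

/-- The transition kernel of the switch-walk-switch walk, as a pushforward of the uniform measure on
the random choices. -/
def swsKernel (α : ℕ+ → ℕ+) (x : Wreath α) : PMF (Wreath α) :=
  (PMF.uniformOfFintype Letter).map (x * increment α ·)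

theorem swsStep_eq_map_increment (α : ℕ+ → ℕ+) :
    swsStep α = (PMF.uniformOfFintype Letter).map (increment α) := by
  simp only [swsStep, baseStep, uniformOfFintype_prod, PMF.map_bind, PMF.bind_map, PMF.map_comp]
  rfl

theorem walk_eq_markovChain (g : Wreath α) (n : ℕ) :
    walk α g n = markovChain (swsKernel α) g n := by
  induction n with
  | zero => rfl
  | succ n ih =>
    simp only [walk, markovChain, ih, swsStep_eq_map_increment, PMF.map_comp]
    rfl

theorem switch_inv (L : ZMod 2) : (switch α L)⁻¹ = switch α L := by
  rw [switch, ← map_inv, ← ofAdd_neg, ← Finsupp.single_neg, ZMod.neg_eq_self_mod_two]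

theorem gen_add_two (i : Fin 4) : gen α (i + 2) = (gen α i)⁻¹ := by
  fin_cases i <;> simp [gen]

theorem increment_reverse (L L' : ZMod 2) (i : Fin 4) :
    increment α (L', i + 2, L) = (increment α (L, i, L'))⁻¹ := by
  simp only [increment, mul_inv_rev, switch_inv, gen_add_two, map_inv, mul_assoc]

theorem swsKernel_apply_comm (x y : Wreath α) : swsKernel α x y = swsKernel α y x := by
  let reverse : Letter → Letter := fun s => (s.2.2, s.2.1 + 2, s.1)
  have hrev : reverse.Involutive := by
    rintro ⟨L, i, L'⟩
    have : i + 2 + 2 = i := by revert i; decide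
    simp only [reverse, this]
  exact map_mul_left_apply_comm _ _ hrev (fun _ => by simp) (fun s => increment_reverse ..) x y

end Kernel

/-! ### Confined elements of the wreath product -/

section ConfinedSet

/-- The elements of the wreath product whose permutation is confined with shift `m` and whose lamps
are off outside the core. -/
def confinedWithShift (α : ℕ+ → ℕ+) (N r : ℕ) (m : ℤ) : Set (Wreath α) :=
  {x | (∀ v, x.left.toAdd v ≠ 0 → v ∈ core α N r 0) ∧ Confined N r m (toPerm x.right)}

/-- The elements of the wreath product that are confined with some shift in `[-r, r]`. -/
def confinedSet (α : ℕ+ → ℕ+) (N r : ℕ) : Set (Wreath α) :=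
  ⋃ m ∈ Finset.Icc (-(r : ℤ)) r, confinedWithShift α N r m

variable {N r : ℕ} {m : ℤ} {x : Wreath α}

theorem mem_confinedSet (hm : |m| ≤ r) (hx : x ∈ confinedWithShift α N r m) :
    x ∈ confinedSet α N r :=
  Set.mem_biUnion (Finset.mem_Icc.2 (abs_le.1 hm)) hx

theorem one_mem_confinedWithShift (N r : ℕ) : (1 : Wreath α) ∈ confinedWithShift α N r 0 :=
  ⟨fun _ hv => absurd rfl hv, Confined.one N r⟩

theorem mul_switch_mem_confinedWithShift (hN : 0 < N) (hx : x ∈ confinedWithShift α N r m)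
    (L : ZMod 2) : x * switch α L ∈ confinedWithShift α N r m := by
  refine ⟨fun v => ?_, ?_⟩
  · contrapose!
    intro hv
    have hlamp : (x * switch α L).left.toAdd v =
        x.left.toAdd v + Finsupp.single (root α) L (toPerm x.right v) := rfl
    have hroot : toPerm x.right v ≠ root α := fun h => by
      have hlen := hx.2.le_length_apply hv
      rw [h] at hlen
      exact hN.not_ge hlen
    rw [hlamp, Finsupp.single_eq_of_ne hroot, add_zero]
    exact not_imp_comm.1 (hx.1 v) hv
  · simpa [switch] using hx.2

theorem mul_gen_mem_confinedWithShift (hα : ∀ k, N ≤ k → 2 * r < (α k.succPNat : ℕ))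
    (hm : |m| ≤ r) (hx : x ∈ confinedWithShift α N r m) (i : Fin 4) :
    x * SemidirectProduct.inr (gen α i) ∈ confinedWithShift α N r (m + genExponent i) := by
  refine ⟨fun v hv => hx.1 v (by simpa using hv), ?_⟩
  change Confined N r (m + genExponent i) (toPerm (gen α i) * toPerm x.right)
  fin_cases i
  · exact hx.2.permA_zpow_mul 1
  · exact (add_zero m).symm ▸ hx.2.permB_mul hα hm
  · exact hx.2.permA_zpow_mul (-1)
  · exact (add_zero m).symm ▸ hx.2.permB_inv_mul hα hm

theorem mul_increment_mem_confinedWithShift (hN : 0 < N)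
    (hα : ∀ k, N ≤ k → 2 * r < (α k.succPNat : ℕ)) (hm : |m| ≤ r)
    (hx : x ∈ confinedWithShift α N r m) (s : Letter) :
    x * increment α s ∈ confinedWithShift α N r (m + genExponent s.2.1) := by
  rw [increment, ← mul_assoc, ← mul_assoc]
  exact mul_switch_mem_confinedWithShift hN
    (mul_gen_mem_confinedWithShift hα hm (mul_switch_mem_confinedWithShift hN hx _) _) _

end ConfinedSet

/-! ### Survival probability -/

section Survival

/-- The frequency for which `m ↦ cos (angle r * m)` is the Dirichlet ground state of the interval
`[-r, r]`: it is positive there and vanishes at `± (r + 1)`. -/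
def angle (r : ℕ) : ℝ := Real.pi / 2 / (r + 1)

/-- The decay rate per step of the lazy walk on `ℤ` killed on leaving `[-r, r]`. -/
def survivalRate (r : ℕ) : ℝ := (1 + Real.cos (angle r)) / 2

/-- The Dirichlet ground state on `[-r, r]` read at the shift of a confined element. Since the shift
is not shown to be unique, the supremum over all possible shifts is taken. -/
def survivalWeight (α : ℕ+ → ℕ+) (N r : ℕ) (x : Wreath α) : ENNReal :=
  ⨆ (m : ℤ) (_ : |m| ≤ r) (_ : x ∈ confinedWithShift α N r m),
    ENNReal.ofReal (Real.cos (angle r * m))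

variable {N r : ℕ} {m : ℤ} {x : Wreath α}

theorem angle_mul_succ (r : ℕ) : angle r * (r + 1) = Real.pi / 2 :=
  div_mul_cancel₀ _ (by positivity)

theorem angle_nonneg (r : ℕ) : 0 ≤ angle r := by
  unfold angle
  positivity

theorem angle_le_pi_div_two (r : ℕ) : angle r ≤ Real.pi / 2 :=
  div_le_self (by positivity) (by simp)

theorem survivalRate_nonneg (r : ℕ) : 0 ≤ survivalRate r := by
  unfold survivalRate
  linarith [Real.neg_one_le_cos (angle r)]

theorem cos_angle_mul_nonneg (hm : |m| ≤ r + 1) : 0 ≤ Real.cos (angle r * m) := by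
  have h : |angle r * m| ≤ Real.pi / 2 := by
    rw [abs_mul, abs_of_nonneg (angle_nonneg r), ← angle_mul_succ r]
    exact mul_le_mul_of_nonneg_left (by exact_mod_cast hm) (angle_nonneg r)
  exact Real.cos_nonneg_of_mem_Icc (abs_le.1 h)

theorem cos_angle_mul_eq_zero (hm : |m| = r + 1) : Real.cos (angle r * m) = 0 := by
  have hm' : |(m : ℝ)| = r + 1 := by exact_mod_cast hm
  rw [← Real.cos_abs, abs_mul, abs_of_nonneg (angle_nonneg r), hm', angle_mul_succ,
    Real.cos_pi_div_two]

theorem sum_cos_angle_mul (r : ℕ) (m : ℤ) :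
    ∑ s : Letter, (16 : ℝ)⁻¹ * Real.cos (angle r * (m + genExponent s.2.1 : ℤ)) =
      survivalRate r * Real.cos (angle r * m) := by
  have hneighbours : Real.cos (angle r * (m + 1 : ℤ)) + Real.cos (angle r * (m + -1 : ℤ)) =
      2 * Real.cos (angle r) * Real.cos (angle r * m) := by
    push_cast
    rw [mul_add, mul_add, mul_one, mul_neg_one, Real.cos_add, ← sub_eq_add_neg, Real.cos_sub]
    ring
  calc ∑ s : Letter, (16 : ℝ)⁻¹ * Real.cos (angle r * (m + genExponent s.2.1 : ℤ))
      = 4⁻¹ * ∑ i, Real.cos (angle r * (m + genExponent i : ℤ)) := by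
        rw [Fintype.sum_prod_type, Finset.mul_sum]
        simp only [Fintype.sum_prod_type, Finset.sum_const, Finset.card_univ, ZMod.card,
          nsmul_eq_mul, ← Finset.mul_sum]
        ring
    _ = survivalRate r * Real.cos (angle r * m) := by
        rw [Fin.sum_univ_four]
        change 4⁻¹ * (Real.cos (angle r * (m + 1 : ℤ)) + Real.cos (angle r * (m + 0 : ℤ)) +
          Real.cos (angle r * (m + -1 : ℤ)) + Real.cos (angle r * (m + 0 : ℤ))) = _
        rw [add_zero, survivalRate]
        linear_combination 4⁻¹ * hneighbours

theorem survivalWeight_le_indicator : survivalWeight α N r ≤ (confinedSet α N r).indicator 1 := by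
  intro x
  refine iSup_le fun m => iSup_le fun hm => iSup_le fun hx => ?_
  rw [Set.indicator_of_mem (mem_confinedSet hm hx)]
  exact ENNReal.ofReal_le_one.2 (Real.cos_le_one _)

theorem ofReal_cos_le_survivalWeight (hm : |m| ≤ r + 1) (hx : x ∈ confinedWithShift α N r m) :
    ENNReal.ofReal (Real.cos (angle r * m)) ≤ survivalWeight α N r x := by
  rcases hm.lt_or_eq with hlt | heq
  · exact le_iSup_of_le m (le_iSup_of_le (Int.lt_add_one_iff.1 hlt) (le_iSup_of_le hx le_rfl))
  · simp [cos_angle_mul_eq_zero heq]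

theorem abs_add_genExponent_le (hm : |m| ≤ r) (i : Fin 4) : |m + genExponent i| ≤ r + 1 := by
  have hi : |genExponent i| ≤ 1 := by fin_cases i <;> simp [genExponent]
  exact (abs_add_le _ _).trans (add_le_add hm hi)

theorem survivalRate_mul_survivalWeight_le (hN : 0 < N)
    (hα : ∀ k, N ≤ k → 2 * r < (α k.succPNat : ℕ)) (x : Wreath α) :
    ENNReal.ofReal (survivalRate r) * survivalWeight α N r x ≤
      ∑' y, swsKernel α x y * survivalWeight α N r y := by
  rw [swsKernel, tsum_map_mul, tsum_fintype]
  conv_lhs => rw [survivalWeight]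
  simp only [ENNReal.mul_iSup, iSup_le_iff]
  intro m hm hx
  have hcos (s : Letter) : 0 ≤ (16 : ℝ)⁻¹ * Real.cos (angle r * (m + genExponent s.2.1 : ℤ)) :=
    mul_nonneg (by norm_num) (cos_angle_mul_nonneg (abs_add_genExponent_le hm _))
  rw [← ENNReal.ofReal_mul (survivalRate_nonneg r), ← sum_cos_angle_mul,
    ENNReal.ofReal_sum_of_nonneg fun s _ => hcos s]
  refine Finset.sum_le_sum fun s _ => ?_
  rw [ENNReal.ofReal_mul (by norm_num)]
  refine mul_le_mul' (le_of_eq ?_) (ofReal_cos_le_survivalWeight (abs_add_genExponent_le hm _)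
    (mul_increment_mem_confinedWithShift hN hα hm hx s))
  rw [PMF.uniformOfFintype_apply, ENNReal.ofReal_inv_of_pos (by norm_num)]
  norm_num

theorem survivalRate_pow_le_toOuterMeasure_markovChain (hN : 0 < N)
    (hα : ∀ k, N ≤ k → 2 * r < (α k.succPNat : ℕ)) (n : ℕ) :
    survivalRate r ^ n ≤
      ((markovChain (swsKernel α) 1 n).toOuterMeasure (confinedSet α N r)).toReal := by
  have hzero : |(0 : ℤ)| ≤ r + 1 := abs_zero.trans_le (by positivity)
  have hone : 1 ≤ survivalWeight α N r 1 := by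
    simpa using ofReal_cos_le_survivalWeight hzero (one_mem_confinedWithShift N r)
  have hfinite : (markovChain (swsKernel α) 1 n).toOuterMeasure (confinedSet α N r) ≠ ⊤ := by
    rw [PMF.toOuterMeasure_apply]
    exact ne_top_of_le_ne_top (PMF.tsum_coe_ne_top _)
      (ENNReal.tsum_le_tsum (Set.indicator_le_self _ _))
  rw [← ENNReal.ofReal_le_iff_le_toReal hfinite, ENNReal.ofReal_pow (survivalRate_nonneg r)]
  exact (le_mul_of_one_le_right' hone).trans (pow_mul_le_toOuterMeasure_markovChain
    (survivalRate_mul_survivalWeight_le hN hα) survivalWeight_le_indicator 1 n)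

end Survival

/-! ### Counting confined elements -/

section Counting

/-- The binary words of length at most `n`. -/
def words (n : ℕ) : Finset (List Bool) :=
  (Finset.range (n + 1)).biUnion fun k =>
    (Finset.univ : Finset (List.Vector Bool k)).image List.Vector.toList

/-- The vertices on the cycles of level at most `n + 1`. -/
def lowVertices (α : ℕ+ → ℕ+) (n : ℕ) : Finset (Vertex α) :=
  (words n).sigma fun _ => Finset.univ

open Classical in
/-- The lamps of an element of the wreath product on the levels up to `N + 2`, and its permutation
on the vertices that it does not move out of these levels. For a fixed shift this data determines a
confined element. -/
def lowCode (α : ℕ+ → ℕ+) (N : ℕ) (x : Wreath α) :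
    (lowVertices α (N + 1) → ZMod 2) × (lowVertices α (N + 1) → lowVertices α (N + 1)) :=
  (fun v => x.left.toAdd v,
    fun v => if h : toPerm x.right v ∈ lowVertices α (N + 1) then ⟨_, h⟩ else v)

theorem mem_words {n : ℕ} {w : List Bool} : w ∈ words n ↔ w.length ≤ n := by
  simp only [words, Finset.mem_biUnion, Finset.mem_range, Nat.lt_succ_iff, Finset.mem_image,
    Finset.mem_univ, true_and]
  exact ⟨fun ⟨k, hk, v, hv⟩ => hv ▸ v.toList_length.trans_le hk,
    fun hw => ⟨w.length, hw, ⟨w, rfl⟩, rfl⟩⟩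

theorem card_words_le (n : ℕ) : (words n).card ≤ 2 ^ (n + 1) :=
  calc (words n).card ≤ ∑ k ∈ Finset.range (n + 1), 2 ^ k :=
        Finset.card_biUnion_le.trans <| Finset.sum_le_sum fun k _ =>
          Finset.card_image_le.trans_eq <| by simp
    _ ≤ 2 ^ (n + 1) := (Nat.geomSum_lt le_rfl fun _ => Finset.mem_range.1).le

theorem mem_lowVertices {n : ℕ} {x : Vertex α} : x ∈ lowVertices α n ↔ x.1.length ≤ n := by
  simp [lowVertices, mem_words]

theorem card_lowVertices_le (hα : ∀ k : ℕ+, (α k : ℕ) ≤ 2 ^ (k : ℕ)) (n : ℕ) :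
    (lowVertices α n).card ≤ 2 ^ (2 * n + 3) := by
  have hcycle (w) (hw : w ∈ words n) :
      (Finset.univ : Finset (ZMod (2 * (α w.length.succPNat : ℕ)))).card ≤ 2 * 2 ^ (n + 1) := by
    rw [Finset.card_univ, ZMod.card]
    exact Nat.mul_le_mul_left _ <| (hα _).trans <|
      Nat.pow_le_pow_right two_pos (Nat.succ_le_succ (mem_words.1 hw))
  calc (lowVertices α n).card ≤ (words n).card * (2 * 2 ^ (n + 1)) := by
        rw [lowVertices, Finset.card_sigma]
        exact Finset.sum_le_card_nsmul _ _ _ hcycle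
    _ ≤ 2 ^ (n + 1) * (2 * 2 ^ (n + 1)) := Nat.mul_le_mul_right _ (card_words_le n)
    _ = 2 ^ (2 * n + 3) := by ring

variable {N r : ℕ} {m : ℤ}

theorem left_apply_eq_zero_of_notMem_lowVertices {x : Wreath α}
    (hx : x ∈ confinedWithShift α N r m) {v : Vertex α} (hv : v ∉ lowVertices α (N + 1)) :
    x.left.toAdd v = 0 := by
  contrapose! hv
  exact mem_lowVertices.2 ((length_le_of_mem_core (hx.1 v hv)).trans N.le_succ)

theorem lowCode_injOn (N r : ℕ) (m : ℤ) :
    Set.InjOn (lowCode α N) (confinedWithShift α N r m) := by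
  intro x hx y hy hxy
  obtain ⟨hlamps, hperm⟩ := Prod.ext_iff.1 hxy
  have hleft : x.left = y.left := by
    refine Multiplicative.toAdd.injective (Finsupp.ext fun v => ?_)
    by_cases hv : v ∈ lowVertices α (N + 1)
    · exact congrFun hlamps ⟨v, hv⟩
    · rw [left_apply_eq_zero_of_notMem_lowVertices hx hv,
        left_apply_eq_zero_of_notMem_lowVertices hy hv]
  have hright : toPerm x.right = toPerm y.right := by
    refine hx.2.eq_of_eq_of_length_le hy.2 fun v hv hxv hyv => ?_
    have h := congrFun hperm ⟨v, mem_lowVertices.2 hv⟩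
    simp only [lowCode, dif_pos (mem_lowVertices.2 hxv), dif_pos (mem_lowVertices.2 hyv)] at h
    exact congrArg Subtype.val h
  exact SemidirectProduct.ext hleft (Subtype.ext (MulOpposite.unop_injective hright))

theorem finite_confinedWithShift (N r : ℕ) (m : ℤ) : (confinedWithShift α N r m).Finite :=
  Set.Finite.of_injOn (Set.mapsTo_univ _ _) (lowCode_injOn N r m) Set.finite_univ

theorem finite_confinedSet (N r : ℕ) : (confinedSet α N r).Finite :=
  Set.Finite.biUnion (Finset.finite_toSet _) fun m _ => finite_confinedWithShift N r m

theorem ncard_confinedWithShift_le (hα : ∀ k : ℕ+, (α k : ℕ) ≤ 2 ^ (k : ℕ)) (N r : ℕ) (m : ℤ) :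
    (confinedWithShift α N r m).ncard ≤ 2 ^ (192 * (N + 1) * 4 ^ N) := by
  have hcode := Set.ncard_le_ncard_of_injOn _ (fun _ _ => Set.mem_univ _)
    (lowCode_injOn (α := α) N r m) Set.finite_univ
  simp only [Set.ncard_univ, Nat.card_prod, Nat.card_fun, Nat.card_eq_finsetCard,
    Nat.card_zmod] at hcode
  have hcard := card_lowVertices_le hα (N + 1)
  set b := (lowVertices α (N + 1)).card
  have hb : b ≤ 32 * 4 ^ N := hcard.trans_eq <| by
    rw [show (4 : ℕ) = 2 ^ 2 from rfl, ← pow_mul]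
    ring
  calc (confinedWithShift α N r m).ncard ≤ 2 ^ b * b ^ b := hcode
    _ ≤ 2 ^ b * (2 ^ (2 * (N + 1) + 3)) ^ b := by gcongr
    _ = 2 ^ ((2 * N + 6) * b) := by rw [← pow_mul, ← pow_add]; ring_nf
    _ ≤ 2 ^ (192 * (N + 1) * 4 ^ N) :=
      Nat.pow_le_pow_right two_pos <| by nlinarith [Nat.mul_le_mul_left (2 * N + 6) hb]

theorem ncard_confinedSet_le (hα : ∀ k : ℕ+, (α k : ℕ) ≤ 2 ^ (k : ℕ)) (hr : r < 2 ^ N) :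
    (confinedSet α N r).ncard ≤ 2 ^ (200 * (N + 1) * 4 ^ N) := by
  have hshifts : (Finset.Icc (-(r : ℤ)) r).card ≤ 2 ^ (N + 1) := by
    rw [Int.card_Icc]
    omega
  calc (confinedSet α N r).ncard
      ≤ ∑ m ∈ Finset.Icc (-(r : ℤ)) r, (confinedWithShift α N r m).ncard :=
        Finset.set_ncard_biUnion_le _ _
    _ ≤ (Finset.Icc (-(r : ℤ)) r).card * 2 ^ (192 * (N + 1) * 4 ^ N) :=
        Finset.sum_le_card_nsmul _ _ _ fun m _ => ncard_confinedWithShift_le hα N r m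
    _ ≤ 2 ^ (N + 1) * 2 ^ (192 * (N + 1) * 4 ^ N) := Nat.mul_le_mul_right _ hshifts
    _ ≤ 2 ^ (200 * (N + 1) * 4 ^ N) := by
      rw [← pow_add]
      exact Nat.pow_le_pow_right two_pos <| by
        nlinarith [Nat.mul_le_mul_left (N + 1) (Nat.one_le_pow N 4 (by norm_num))]

end Counting

/-! ### The return probability -/

section ReturnProbability

variable {N r : ℕ}

theorem survivalRate_pow_le_ncard_mul_transProb (hN : 0 < N)
    (hα : ∀ k, N ≤ k → 2 * r < (α k.succPNat : ℕ)) (n : ℕ) :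
    survivalRate r ^ (2 * n) ≤ (confinedSet α N r).ncard * transProb α (2 * n) 1 1 := by
  rw [mul_comm 2 n, pow_mul, mul_comm n 2, transProb, walk_eq_markovChain]
  calc (survivalRate r ^ n) ^ 2
      ≤ ((markovChain (swsKernel α) 1 n).toOuterMeasure (confinedSet α N r)).toReal ^ 2 :=
        pow_le_pow_left₀ (pow_nonneg (survivalRate_nonneg r) n)
          (survivalRate_pow_le_toOuterMeasure_markovChain hN hα n) 2
    _ ≤ _ := sq_toOuterMeasure_markovChain_le swsKernel_apply_comm 1 n (finite_confinedSet N r)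

theorem exp_neg_sq_le_one_add_cos_div_two {θ : ℝ} (h : θ ^ 2 ≤ 3) :
    Real.exp (-θ ^ 2) ≤ (1 + Real.cos θ) / 2 := by
  have hpos : 0 < 1 - θ ^ 2 / 4 := by linarith
  have hinv : (1 - θ ^ 2 / 4)⁻¹ ≤ 1 + θ ^ 2 := by
    rw [inv_le_iff_one_le_mul₀ hpos]
    nlinarith [sq_nonneg θ]
  calc Real.exp (-θ ^ 2) ≤ Real.exp (Real.log (1 - θ ^ 2 / 4)) :=
        Real.exp_le_exp.2 (by linarith [Real.one_sub_inv_le_log_of_pos hpos])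
    _ = 1 - θ ^ 2 / 4 := Real.exp_log hpos
    _ ≤ (1 + Real.cos θ) / 2 := by linarith [Real.one_sub_sq_div_two_le_cos (x := θ)]

theorem exp_neg_le_survivalRate_pow (r n : ℕ) :
    Real.exp (-(5 * n / (r + 1) ^ 2)) ≤ survivalRate r ^ (2 * n) := by
  have hpi : Real.pi ^ 2 ≤ 10 := by nlinarith [Real.pi_pos, Real.pi_lt_d2]
  have hangle : angle r ^ 2 ≤ 3 := by
    nlinarith [angle_nonneg r, angle_le_pi_div_two r]
  calc Real.exp (-(5 * n / (r + 1) ^ 2)) ≤ Real.exp ((2 * n : ℕ) * -angle r ^ 2) := by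
        have hexponent : (2 * n : ℕ) * angle r ^ 2 = Real.pi ^ 2 * n / 2 / (r + 1) ^ 2 := by
          rw [angle, div_pow _ ((r : ℝ) + 1)]
          push_cast
          ring
        rw [Real.exp_le_exp, mul_neg, hexponent, neg_le_neg_iff]
        gcongr
        nlinarith [n.cast_nonneg (α := ℝ)]
    _ = Real.exp (-angle r ^ 2) ^ (2 * n) := Real.exp_nat_mul _ _
    _ ≤ survivalRate r ^ (2 * n) := by
        gcongr
        exact exp_neg_sq_le_one_add_cos_div_two hangle

theorem exp_neg_le_transProb (hα : ∀ k : ℕ+, (α k : ℕ) ≤ 2 ^ (k : ℕ)) (hN : 0 < N)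
    (hr : ∀ k, N ≤ k → 2 * r < (α k.succPNat : ℕ)) (n : ℕ) :
    Real.exp (-(5 * n / (r + 1) ^ 2 + 200 * (N + 1) * 4 ^ N)) ≤ transProb α (2 * n) 1 1 := by
  have hrN : r < 2 ^ N := by
    have := (hr N le_rfl).trans_le (hα _)
    rw [Nat.succPNat_coe, Nat.succ_eq_add_one, pow_succ'] at this
    omega
  have hcard : ((confinedSet α N r).ncard : ℝ) ≤ Real.exp (200 * (N + 1) * 4 ^ N) :=
    calc ((confinedSet α N r).ncard : ℝ) ≤ 2 ^ (200 * (N + 1) * 4 ^ N) := by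
          exact_mod_cast ncard_confinedSet_le hα hrN
      _ ≤ Real.exp 1 ^ (200 * (N + 1) * 4 ^ N) := by
          gcongr
          linarith [Real.add_one_le_exp 1]
      _ = Real.exp (200 * (N + 1) * 4 ^ N) := by
          rw [← Real.exp_nat_mul]
          push_cast
          rw [mul_one]
  rw [neg_add, Real.exp_add, Real.exp_neg (200 * _ * _), ← div_eq_mul_inv,
    div_le_iff₀' (Real.exp_pos _)]
  calc Real.exp (-(5 * n / (r + 1) ^ 2)) ≤ survivalRate r ^ (2 * n) :=
        exp_neg_le_survivalRate_pow r n
    _ ≤ (confinedSet α N r).ncard * transProb α (2 * n) 1 1 :=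
        survivalRate_pow_le_ncard_mul_transProb hN hr n
    _ ≤ Real.exp (200 * (N + 1) * 4 ^ N) * transProb α (2 * n) 1 1 :=
        mul_le_mul_of_nonneg_right hcard ENNReal.toReal_nonneg

end ReturnProbability

/-! ### The scaling sequence -/

section Scaling

theorem scaling_le_two_pow (k : ℕ+) : (scaling k : ℕ) ≤ 2 ^ (k : ℕ) := by
  refine Nat.ceil_le.2 ?_
  push_cast
  exact div_le_self (by positivity) (one_le_pow₀ (by exact_mod_cast k.pos))

theorem coe_scaling_succPNat (k : ℕ) :
    (scaling k.succPNat : ℕ) = ⌈(2 : ℝ) ^ (k + 1) / (k + 1) ^ 2⌉₊ := by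
  simp [scaling]

theorem scaling_succPNat_le {N k : ℕ} (hN : 2 ≤ N) (hNk : N ≤ k) :
    (scaling N.succPNat : ℕ) ≤ scaling k.succPNat := by
  induction k, hNk using Nat.le_induction with
  | base => rfl
  | succ k hNk ih =>
    refine ih.trans ?_
    rw [coe_scaling_succPNat, coe_scaling_succPNat]
    refine Nat.ceil_mono ?_
    have hk : (2 : ℝ) ≤ k := by exact_mod_cast hN.trans hNk
    have hsq : ((k + 1 : ℕ) + 1 : ℝ) ^ 2 ≤ 2 * (k + 1) ^ 2 := by
      push_cast
      nlinarith
    rw [div_le_div_iff₀ (by positivity) (by positivity), pow_succ 2 (k + 1), mul_assoc]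
    gcongr

theorem exp_neg_le_transProb_scaling {N : ℕ} (hN : 2 ≤ N) (n : ℕ) :
    Real.exp (-(5 * n * (N + 1) ^ 4 / 4 ^ N + 200 * (N + 1) * 4 ^ N)) ≤
      transProb scaling (2 * n) 1 1 := by
  obtain ⟨r, hr, hr'⟩ : ∃ r : ℕ, 2 * r < (scaling N.succPNat : ℕ) ∧
      (scaling N.succPNat : ℕ) ≤ 2 * (r + 1) :=
    ⟨(scaling N.succPNat - 1) / 2, by have := (scaling N.succPNat).pos; omega, by omega⟩
  have hradius : (2 : ℝ) ^ N / (N + 1) ^ 2 ≤ r + 1 := by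
    rw [coe_scaling_succPNat, Nat.ceil_le, pow_succ'] at hr'
    push_cast at hr'
    linarith [mul_div_assoc (2 : ℝ) (2 ^ N) ((N + 1) ^ 2)]
  have hfirst : 5 * (n : ℝ) / ((r : ℝ) + 1) ^ 2 ≤ 5 * n * (N + 1) ^ 4 / 4 ^ N :=
    calc 5 * (n : ℝ) / ((r : ℝ) + 1) ^ 2 ≤ 5 * (n : ℝ) / (2 ^ N / (N + 1) ^ 2) ^ 2 := by gcongr
      _ = 5 * (n : ℝ) * (N + 1) ^ 4 / 4 ^ N := by
        rw [show (4 : ℝ) = 2 ^ 2 by norm_num, ← pow_mul]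
        field_simp
        ring
  refine le_trans (Real.exp_le_exp.2 ?_) (exp_neg_le_transProb (r := r) scaling_le_two_pow
    (by omega) (fun k hk => hr.trans_le (scaling_succPNat_le hN hk)) n)
  linarith

end Scaling

/-! ### Choice of the level -/

section Asymptotics

variable {n : ℕ}

theorem four_pow_natLog_sixteen_le_sqrt (hn : n ≠ 0) : (4 : ℝ) ^ Nat.log 16 n ≤ √n := by
  refine Real.le_sqrt_of_sq_le ?_
  rw [← pow_mul, mul_comm, pow_mul]
  exact_mod_cast Nat.pow_log_le_self 16 hn

theorem sqrt_le_four_pow_natLog_sixteen (n : ℕ) : √n ≤ 4 ^ (Nat.log 16 n + 1) := by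
  refine Real.sqrt_le_iff.2 ⟨by positivity, ?_⟩
  rw [← pow_mul, mul_comm, pow_mul]
  exact_mod_cast (Nat.lt_pow_succ_log_self (by norm_num) n).le

theorem natLog_sixteen_le_log (n : ℕ) : (Nat.log 16 n : ℝ) ≤ Real.log n := by
  have hlog : 1 ≤ Real.log 16 := by
    rw [Real.le_log_iff_exp_le (by norm_num)]
    linarith [Real.exp_one_lt_d9]
  exact (Real.natLog_le_logb n 16).trans (div_le_self (Real.log_natCast_nonneg n) hlog)

theorem exponent_le_sqrt_mul_one_add_log_pow (hn : n ≠ 0) {N : ℕ} (hN : N = Nat.log 16 n + 2) :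
    5 * n * ((N : ℝ) + 1) ^ 4 / 4 ^ N + 200 * (N + 1) * 4 ^ N ≤
      10005 * (√n * (1 + Real.log n) ^ 4) := by
  have hlog := Real.log_natCast_nonneg n
  have hN' : (N : ℝ) + 1 ≤ 3 * (1 + Real.log n) := by
    rw [hN]
    push_cast
    linarith [natLog_sixteen_le_log n]
  have hpow : (4 : ℝ) ^ N ≤ 16 * √n := by
    rw [hN, pow_add]
    linarith [four_pow_natLog_sixteen_le_sqrt hn]
  have hdiv : n / (4 : ℝ) ^ N ≤ √n := by
    rw [div_le_iff₀ (by positivity)]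
    calc (n : ℝ) = √n * √n := (Real.mul_self_sqrt n.cast_nonneg).symm
      _ ≤ √n * 4 ^ N := by
        gcongr
        exact (sqrt_le_four_pow_natLog_sixteen n).trans (pow_le_pow_right₀ (by norm_num) (by omega))
  calc 5 * n * ((N : ℝ) + 1) ^ 4 / 4 ^ N + 200 * (N + 1) * 4 ^ N
      = 5 * ((N : ℝ) + 1) ^ 4 * (n / 4 ^ N) + 200 * (N + 1) * 4 ^ N := by ring
    _ ≤ 5 * (3 * (1 + Real.log n)) ^ 4 * √n + 200 * (3 * (1 + Real.log n)) * (16 * √n) := by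
        gcongr
    _ = √n * (405 * (1 + Real.log n) ^ 4 + 9600 * (1 + Real.log n)) := by ring
    _ ≤ √n * (405 * (1 + Real.log n) ^ 4 + 9600 * (1 + Real.log n) ^ 4) := by
        gcongr
        exact le_self_pow₀ (by linarith) (by norm_num)
    _ = 10005 * (√n * (1 + Real.log n) ^ 4) := by ring

theorem exp_neg_sqrt_mul_le_transProb_scaling (hn : n ≠ 0) :
    Real.exp (-(10005 * (√n * (1 + Real.log n) ^ 4))) ≤ transProb scaling (2 * n) 1 1 :=
  (Real.exp_le_exp.2 (neg_le_neg (exponent_le_sqrt_mul_one_add_log_pow hn rfl))).trans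
    (exp_neg_le_transProb_scaling le_add_self n)

/-- The correction to the exponent `1/2` that turns `√n` into `√n * (1 + log n) ^ 4`. -/
def exponentCorrection (n : ℕ) : ℝ := 4 * Real.logb n (1 + Real.log n)

theorem tendsto_exponentCorrection : Tendsto exponentCorrection atTop (𝓝 0) := by
  have hlog : Tendsto (fun x : ℝ => Real.log (1 + x) / x) atTop (𝓝 0) := by
    have hlittle := Real.isLittleO_log_id_atTop.comp_tendsto
      (tendsto_atTop_add_const_left atTop (1 : ℝ) tendsto_id)
    have hbig : (fun x : ℝ => 1 + x) =O[atTop] fun x => x :=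
      (Asymptotics.isLittleO_const_id_atTop (1 : ℝ)).isBigO.add (Asymptotics.isBigO_refl _ _)
    exact (hlittle.trans_isBigO hbig).tendsto_div_nhds_zero
  have hcomp := (hlog.comp (Real.tendsto_log_atTop.comp tendsto_natCast_atTop_atTop)).const_mul 4
  rwa [mul_zero] at hcomp

theorem rpow_half_add_exponentCorrection (hn : n ≠ 0) :
    (n : ℝ) ^ (1 / 2 + exponentCorrection n) = √n * (1 + Real.log n) ^ 4 := by
  have hn0 : (0 : ℝ) < n := by positivity
  have hlog := Real.log_natCast_nonneg n
  rw [Real.rpow_add hn0, ← Real.sqrt_eq_rpow]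
  congr 1
  rcases eq_or_ne n 1 with rfl | hn1
  · simp
  · rw [exponentCorrection, mul_comm, Real.rpow_mul hn0.le,
      Real.rpow_logb hn0 (by exact_mod_cast hn1) (by linarith)]
    norm_cast

end Asymptotics

end BubbleGroup

end

theorem mainTheorem7 :
    ∃ f : ℕ → ℝ, Tendsto f atTop (𝓝 0) ∧
      ∃ c : ℝ, 0 < c ∧ ∃ K : ℝ, 0 < K ∧ ∀ n : ℕ, 1 ≤ n →
        K * Real.exp (-c * (n : ℝ) ^ ((1 / 2 : ℝ) + f n)) ≤
          BubbleGroup.transProb BubbleGroup.scaling (2 * n) 1 1 := by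
  refine ⟨BubbleGroup.exponentCorrection, BubbleGroup.tendsto_exponentCorrection, 10005,
    by norm_num, 1, one_pos, fun n hn => ?_⟩
  have hn0 : n ≠ 0 := Nat.one_le_iff_ne_zero.1 hn
  rw [BubbleGroup.rpow_half_add_exponentCorrection hn0, one_mul, neg_mul]
  exact BubbleGroup.exp_neg_sqrt_mul_le_transProb_scaling hn0
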